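/- Consider the following game between two players, Alice and Bob, played in rounds $t=0,1,2,\dots$. There are two arms: a predictable arm $L$ with known success probability $p$, and a risky arm $R$ whose success probability $\Theta$ is drawn once, before the game, from the uniform distribution on $[0,1]$. The number $p$ and the prior of $R$ are common knowledge; $\Theta$ is not observed. In every round both players simultaneously pull an arm, and each player collects a reward in $\{0,1\}$ from the arm that he pulled; given $\Theta$, this reward is a Bernoulli variable with the success probability of that arm, drawn independently for each player and each round. After the round each player observes his own reward and the arm pulled by the other player, but not the other player's reward. A pure strategy of a player is a function that selects an arm for each history of the actions of both players and of his own rewards in the past rounds; a mixed strategy is a probability distribution over pure strategies, and the players randomize independently of each other and of Nature. Let $\beta\in(0,1)$ be the discount factor, let $\gamma_i(t)$ be the reward of player $i$ in round $t$, and let $\Gamma_i=\sum_{t=0}^{\infty}\gamma_i(t)\,\beta^t$. In the zero-sum game the utilities are $u_A=\Gamma_A-\Gamma_B$ and $u_B=\Gamma_B-\Gamma_A$. A pair of mixed strategies is an equilibrium (Bayesian Nash equilibrium) if no player can increase his expected utility by changing his own strategy. Let $2-\sqrt2<p\le 1$. Then for every $\beta\in(0,1)$ and every equilibrium of this zero-sum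 game, with probability $1$ neither player ever pulls arm $R$. -/

import Mathlib

open MeasureTheory

namespace OneArmedBandit

/-- The two arms: `L` is the predictable arm, `R` is the risky arm. -/
inductive Arm where
  | L
  | R

instance : MeasurableSpace Arm := ⊤

inductive Player where
  | alice
  | bob

/-- The opponent of a player. -/
def Player.other : Player → Player
  | .alice => .bob
  | .bob => .alice

/-- What a player observes in one round: the arm he pulled himself, the arm pulled by the other
player, and his own reward bit. -/
abbrev Observation := Arm × Arm × Bool

/-- The information of a player at the start of round `t`: the list, latest round first, of his
observations in rounds `0, …, t - 1` (the public history together with his private history). -/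
abbrev History := List Observation

/-- A pure strategy selects an arm for each history. -/
abbrev PureStrategy := History → Arm

/-- A mixed strategy is a probability distribution over pure strategies, for the product
`σ`-algebra on `History → Arm`. -/
abbrev MixedStrategy := ProbabilityMeasure PureStrategy

/-- States of Nature: the success probability of arm `R`, and for each player `i` and each round `t`
a number in `[0, 1]` that decides the reward of player `i` in round `t`. -/
abbrev Nature := unitInterval × (Player × ℕ → unitInterval)

/-- The law of Nature: the success probability of `R` is drawn from the prior `μ`, and independently
of it the numbers deciding the rewards are independent and uniform on `[0, 1]`. -/
noncomputable def natureLaw (μ : Measure unitInterval) : Measure Nature :=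
  μ.prod (Measure.infinitePi fun _ : Player × ℕ => (volume : Measure unitInterval))

/-- The success probability of an arm: `p` for `L`, and the number drawn by Nature for `R`. -/
def successProb (p : ℝ) (ω : Nature) : Arm → ℝ
  | .L => p
  | .R => ω.1

/-- The reward bit of player `i` in round `t` if he pulls arm `a`. Given the success probability `q`
of the arm it is a Bernoulli variable of parameter `q`, drawn afresh for each player and round. -/
noncomputable def rewardBit (p : ℝ) (ω : Nature) (i : Player) (t : ℕ) (a : Arm) : Bool :=
  decide ((ω.2 (i, t) : ℝ) < successProb p ω a)

/-- The history of each player at the start of round `t` when player `j` uses the pure strategy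
`S j`. -/
noncomputable def history (p : ℝ) (S : Player → PureStrategy) (ω : Nature) :
    ℕ → Player → History
  | 0, _ => []
  | t + 1, i =>
    (S i (history p S ω t i), S i.other (history p S ω t i.other),
      rewardBit p ω i t (S i (history p S ω t i))) :: history p S ω t i

/-- The arm pulled by player `i` in round `t`. -/
noncomputable def action (p : ℝ) (S : Player → PureStrategy) (ω : Nature) (i : Player) (t : ℕ) :
    Arm :=
  S i (history p S ω t i)

/-- The reward `γ_i(t)` of player `i` in round `t`. -/
noncomputable def reward (p : ℝ) (S : Player → PureStrategy) (ω : Nature) (i : Player) (t : ℕ) :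
    ℝ :=
  if rewardBit p ω i t (action p S ω i t) then 1 else 0

/-- The total discounted reward `Γ_i` of player `i`. -/
noncomputable def totalReward (p β : ℝ) (S : Player → PureStrategy) (ω : Nature) (i : Player) : ℝ :=
  ∑' t : ℕ, reward p S ω i t * β ^ t

/-- The utility `u_i = Γ_i + lam * Γ_j` of player `i`, where `j` is the other player. -/
noncomputable def utility (p β lam : ℝ) (S : Player → PureStrategy) (ω : Nature) (i : Player) : ℝ :=
  totalReward p β S ω i + lam * totalReward p β S ω i.other

/-- The pair of pure strategies in which Alice uses `s.1` and Bob uses `s.2`. -/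
def profile (s : PureStrategy × PureStrategy) : Player → PureStrategy
  | .alice => s.1
  | .bob => s.2

/-- The joint law of the pure strategies selected by Alice and Bob, who randomize independently, and
of the state of Nature. -/
noncomputable def gameLaw (μ : Measure unitInterval) (σA σB : MixedStrategy) :
    Measure ((PureStrategy × PureStrategy) × Nature) :=
  ((σA : Measure PureStrategy).prod (σB : Measure PureStrategy)).prod (natureLaw μ)

/-- The expected utility of player `i` under a pair of mixed strategies. -/
noncomputable def expectedUtility (μ : Measure unitInterval) (p β lam : ℝ)
    (σA σB : MixedStrategy) (i : Player) : ℝ :=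
  ∫ x, utility p β lam (profile x.1) x.2 i ∂(gameLaw μ σA σB)

/-- `(σA, σB)` is a (Bayesian) Nash equilibrium: each strategy is a best response to the other. -/
def IsNashEquilibrium (μ : Measure unitInterval) (p β lam : ℝ) (σA σB : MixedStrategy) : Prop :=
  (∀ τ : MixedStrategy,
    expectedUtility μ p β lam τ σB .alice ≤ expectedUtility μ p β lam σA σB .alice) ∧
  (∀ τ : MixedStrategy,
    expectedUtility μ p β lam σA τ .bob ≤ expectedUtility μ p β lam σA σB .bob)

end OneArmedBandit

/-! The game is symmetric and zero-sum, so an equilibrium strategy earns at least `0` against every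
reply, in particular against `copycat`, which imitates with a lag of one round every pull of `R`
except the first.

Fix `θ`. Let `W` be the discount factor at Alice's first pull of `R` (`0` if there is none) and `Y`
the discounted number of her later pulls. With rewards replaced by success probabilities, her lead
over the copycat is `(θ - p) * (W + (1 - β) * Y)`, and `(1 - β) * Y ≤ β * W`, so it is at most `W *
((θ - p) + β * max (θ - p) 0)` (`tsum_sub_tsum_copy_le`). Before the first pull nothing depends on
`θ`, so `W` is independent of it (`firstPullWeight_congr`), and the expected lead is at most `((1 /
2 - p) + β * (1 - p) ^ 2 / 2) * E[W]`. For `p > 2 - √2` the constant is negative, hence `W = 0`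
almost surely: an equilibrium strategy never pulls `R` against the copycat.

The same holds for Bob by exchanging the players. Two such strategies facing each other see only
`L`, exactly as against the copycat, so neither ever departs from it (`action_eq_L_of_copycat`). -/

namespace OneArmedBandit

/-! ### Measurability -/

instance : Countable Arm :=
  Function.Injective.countable (f := fun a : Arm => match a with | .L => false | .R => true)
    (by rintro (_ | _) (_ | _) h <;> simp_all)

instance : Countable Player :=
  Function.Injective.countable
    (f := fun a : Player => match a with | .alice => false | .bob => true)
    (by rintro (_ | _) (_ | _) h <;> simp_all)

lemma Arm.ne_L_iff {a : Arm} : a ≠ .L ↔ a = .R := by cases a <;> simp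

@[simp] lemma Player.other_other (i : Player) : i.other.other = i := by cases i <;> rfl

lemma measurable_profile_apply (i : Player) (h : History) :
    Measurable fun s : PureStrategy × PureStrategy => profile s i h := by
  cases i
  · exact (measurable_pi_apply h).comp measurable_fst
  · exact (measurable_pi_apply h).comp measurable_snd

/-- There are countably many histories, so a strategy evaluated at a random history is handled fibre
by fibre, with no `σ`-algebra on `History`. -/
lemma measurable_apply_of_measurableSet_fiber {α : Type*} [MeasurableSpace α]
    {S : α → PureStrategy} (hS : ∀ h, Measurable fun x => S x h) {H : α → History}
    (hH : ∀ h, MeasurableSet {x | H x = h}) : Measurable fun x => S x (H x) := by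
  intro A hA
  have : (fun x => S x (H x)) ⁻¹' A = ⋃ h, {x | H x = h} ∩ (fun x => S x h) ⁻¹' A := by
    ext x; simp
  rw [this]
  exact MeasurableSet.iUnion fun h => (hH h).inter (hS h hA)

lemma measurable_successProb {α : Type*} [MeasurableSpace α] (p : ℝ) {w : α → Nature}
    (hw : Measurable w) {a : α → Arm} (ha : Measurable a) :
    Measurable fun x => successProb p (w x) (a x) := by
  classical
  have : (fun x => successProb p (w x) (a x)) =
      fun x => if a x ∈ ({Arm.L} : Set Arm) then p else ((w x).1 : ℝ) := by
    ext x
    cases h : a x <;> simp [successProb]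
  rw [this]
  refine Measurable.ite (ha trivial) measurable_const ?_
  exact measurable_subtype_coe.comp (measurable_fst.comp hw)

lemma measurable_rewardBit {α : Type*} [MeasurableSpace α] (p : ℝ) (i : Player) (t : ℕ)
    {w : α → Nature} (hw : Measurable w) {a : α → Arm} (ha : Measurable a) :
    Measurable fun x => rewardBit p (w x) i t (a x) := by
  apply measurable_to_bool
  have : (fun x => rewardBit p (w x) i t (a x)) ⁻¹' {true} =
      {x | ((w x).2 (i, t) : ℝ) < successProb p (w x) (a x)} := by
    ext x; simp [rewardBit]
  rw [this]
  refine measurableSet_lt ?_ (measurable_successProb p hw ha)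
  exact measurable_subtype_coe.comp ((measurable_pi_apply _).comp (measurable_snd.comp hw))

lemma measurableSet_history_eq (p : ℝ) (t : ℕ) (i : Player) (h : History) :
    MeasurableSet {x : (PureStrategy × PureStrategy) × Nature |
      history p (profile x.1) x.2 t i = h} := by
  induction t generalizing i h with
  | zero => simp [history]
  | succ t ih =>
    have hact : ∀ j, Measurable fun x : (PureStrategy × PureStrategy) × Nature =>
        profile x.1 j (history p (profile x.1) x.2 t j) := fun j =>
      measurable_apply_of_measurableSet_fiber
        (fun h => (measurable_profile_apply j h).comp measurable_fst) (ih j)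
    have hbit := measurable_rewardBit p i t
      (measurable_snd : Measurable fun x : (PureStrategy × PureStrategy) × Nature => x.2) (hact i)
    cases h with
    | nil => simp [history]
    | cons o h =>
      obtain ⟨a, b, c⟩ := o
      simp only [history, List.cons.injEq, Prod.mk.injEq]
      exact ((hact i (show MeasurableSet {a} from trivial)).inter
        ((hact i.other (show MeasurableSet {b} from trivial)).inter
          (hbit (measurableSet_singleton c)))).inter (ih i h)

lemma measurable_action (p : ℝ) (i : Player) (t : ℕ) :
    Measurable fun x : (PureStrategy × PureStrategy) × Nature =>
      action p (profile x.1) x.2 i t :=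
  measurable_apply_of_measurableSet_fiber
    (fun h => (measurable_profile_apply i h).comp measurable_fst) (measurableSet_history_eq p t i)

lemma measurable_reward (p : ℝ) (i : Player) (t : ℕ) :
    Measurable fun x : (PureStrategy × PureStrategy) × Nature =>
      reward p (profile x.1) x.2 i t :=
  Measurable.ite (measurable_rewardBit p i t measurable_snd (measurable_action p i t)
    (measurableSet_singleton true)) measurable_const measurable_const

lemma reward_mem_Icc (p : ℝ) (S : Player → PureStrategy) (ω : Nature) (i : Player) (t : ℕ) :
    reward p S ω i t ∈ Set.Icc (0 : ℝ) 1 := by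
  unfold reward; split_ifs <;> simp

lemma summable_mul_pow_of_mem_Icc {β : ℝ} (hβ0 : 0 < β) (hβ1 : β < 1) {f : ℕ → ℝ}
    (hf : ∀ t, f t ∈ Set.Icc (0 : ℝ) 1) : Summable fun t => f t * β ^ t :=
  Summable.of_nonneg_of_le (fun t => mul_nonneg (hf t).1 (by positivity))
    (fun t => mul_le_of_le_one_left (by positivity) (hf t).2)
    (summable_geometric_of_lt_one hβ0.le hβ1)

lemma measurable_totalReward (p β : ℝ) (i : Player) :
    Measurable fun x : (PureStrategy × PureStrategy) × Nature =>
      totalReward p β (profile x.1) x.2 i :=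
  Measurable.tsum fun t => (measurable_reward p i t).mul_const _

/-! ### The lagged copycat -/

open Classical in
/-- Pull `R` exactly when the opponent pulled `R` in the previous round and also in some round
before that one. -/
noncomputable def copycat : PureStrategy
  | [] => .L
  | o :: h => if o.2.1 = .R ∧ ∃ o' ∈ h, o'.2.1 = .R then .R else .L

lemma exists_mem_history_iff (p : ℝ) (S : Player → PureStrategy) (ω : Nature) (i : Player) (t : ℕ) :
    (∃ o ∈ history p S ω t i, o.2.1 = .R) ↔ ∃ s < t, action p S ω i.other s = .R := by
  induction t with
  | zero => simp [history]
  | succ t ih =>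
    simp only [history, List.mem_cons, exists_eq_or_imp, ih, Nat.lt_succ_iff_lt_or_eq]
    constructor
    · rintro (h | ⟨s, hs, h⟩)
      · exact ⟨t, .inr rfl, h⟩
      · exact ⟨s, .inl hs, h⟩
    · rintro ⟨s, hs | rfl, h⟩
      · exact .inr ⟨s, hs, h⟩
      · exact .inl h

lemma action_copycat_zero (p : ℝ) (s : PureStrategy) (ω : Nature) :
    action p (profile (s, copycat)) ω .bob 0 = .L := by
  simp [action, history, profile, copycat]

lemma action_copycat_succ (p : ℝ) (s : PureStrategy) (ω : Nature) (t : ℕ) :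
    action p (profile (s, copycat)) ω .bob (t + 1) = .R ↔
      action p (profile (s, copycat)) ω .alice t = .R ∧
        ∃ r < t, action p (profile (s, copycat)) ω .alice r = .R := by
  have h := exists_mem_history_iff p (profile (s, copycat)) ω .bob t
  rw [Player.other] at h
  rw [← h]
  classical
  change (if action p (profile (s, copycat)) ω .alice t = .R ∧
    ∃ o ∈ history p (profile (s, copycat)) ω t .bob, o.2.1 = .R then Arm.R else Arm.L) = .R ↔ _
  split_ifs with h' <;> simpa using h'

/-- Until Alice has pulled `R`, the play against the copycat does not depend on the success
probability of `R`. -/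
lemma history_copycat_congr (p : ℝ) (s : PureStrategy) (θ θ' : unitInterval)
    (u : Player × ℕ → unitInterval) (t : ℕ)
    (h : ∀ r < t, action p (profile (s, copycat)) (θ, u) .alice r = .L) (i : Player) :
    history p (profile (s, copycat)) (θ, u) t i = history p (profile (s, copycat)) (θ', u) t i := by
  induction t generalizing i with
  | zero => rfl
  | succ t ih =>
    have ih := ih fun r hr => h r (hr.trans (Nat.lt_succ_self t))
    have hL : ∀ j, action p (profile (s, copycat)) (θ, u) j t = .L := by
      rintro (_ | _)
      · exact h t (Nat.lt_succ_self t)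
      · cases t with
        | zero => exact action_copycat_zero _ _ _
        | succ t =>
          by_contra hc
          rw [← ne_eq, Arm.ne_L_iff, action_copycat_succ] at hc
          rw [h t (by omega)] at hc
          simp at hc
    simp only [action] at hL
    have hi := hL i
    simp only [history, ← ih, hi, rewardBit, successProb]

/-- Alice pulls `R` in round `t` for the first time. -/
def FirstPull (p : ℝ) (s : PureStrategy) (ω : Nature) (t : ℕ) : Prop :=
  action p (profile (s, copycat)) ω .alice t = .R ∧
    ∀ r < t, action p (profile (s, copycat)) ω .alice r = .L

/-- The action in round `t` itself uses only information from earlier rounds, all spent on `L`; so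
the time of the first pull is a function of `u` alone. -/
lemma FirstPull.congr {p : ℝ} {s : PureStrategy} {θ : unitInterval}
    {u : Player × ℕ → unitInterval} {t : ℕ} (h : FirstPull p s (θ, u) t) (θ' : unitInterval) :
    FirstPull p s (θ', u) t := by
  have key : ∀ r ≤ t, action p (profile (s, copycat)) (θ', u) .alice r =
      action p (profile (s, copycat)) (θ, u) .alice r := fun r hr => by
    rw [action, action, history_copycat_congr p s θ θ' u r fun q hq => h.2 q (by omega)]
  exact ⟨(key t le_rfl).trans h.1, fun r hr => (key r hr.le).trans (h.2 r hr)⟩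

lemma firstPull_congr (p : ℝ) (s : PureStrategy) (θ θ' : unitInterval)
    (u : Player × ℕ → unitInterval) (t : ℕ) : FirstPull p s (θ, u) t ↔ FirstPull p s (θ', u) t :=
  ⟨fun h => h.congr θ', fun h => h.congr θ⟩

/-! ### Pathwise comparison with the copycat -/

open Classical in
lemma tsum_sub_tsum_copy_le {β : ℝ} (hβ0 : 0 < β) (hβ1 : β < 1) {p θ : ℝ} (a b : ℕ → Prop)
    (hb0 : ¬ b 0) (hb : ∀ t, b (t + 1) ↔ a t ∧ ∃ r < t, a r) :
    (∑' t, (if a t then θ else p) * β ^ t) - ∑' t, (if b t then θ else p) * β ^ t ≤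
      (∑' t, (if a t ∧ ∀ r < t, ¬ a r then 1 else 0) * β ^ t) *
        ((θ - p) + β * max (θ - p) 0) := by
  -- `n` marks the first pull, `y` the later pulls, `e` all rounds after the first pull.
  set n : ℕ → ℝ := fun t => if a t ∧ ∀ r < t, ¬ a r then 1 else 0 with hn
  set y : ℕ → ℝ := fun t => if a t ∧ ∃ r < t, a r then 1 else 0 with hy
  set e : ℕ → ℝ := fun t => if ∃ r < t, a r then 1 else 0 with he
  have ite_mem : ∀ (P : Prop) [Decidable P], (if P then (1 : ℝ) else 0) ∈ Set.Icc (0 : ℝ) 1 := by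
    intro P _; split_ifs <;> simp
  have hsn : Summable fun t => n t * β ^ t :=
    summable_mul_pow_of_mem_Icc hβ0 hβ1 fun t => ite_mem _
  have hsy : Summable fun t => y t * β ^ t :=
    summable_mul_pow_of_mem_Icc hβ0 hβ1 fun t => ite_mem _
  have hse : Summable fun t => e t * β ^ t :=
    summable_mul_pow_of_mem_Icc hβ0 hβ1 fun t => ite_mem _
  have hg := summable_geometric_of_lt_one hβ0.le hβ1
  have hA : ∑' t, (if a t then θ else p) * β ^ t =
      p * (∑' t, β ^ t) + (θ - p) * ((∑' t, n t * β ^ t) + ∑' t, y t * β ^ t) := by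
    rw [← tsum_mul_left, ← hsn.tsum_add hsy, ← tsum_mul_left,
      ← (hg.mul_left p).tsum_add ((hsn.add hsy).mul_left _)]
    congr 1 with t
    simp only [hn, hy]
    by_cases h1 : a t
    · by_cases h2 : ∃ r < t, a r
      · have h3 : ¬ ∀ r < t, ¬ a r := by push Not; exact h2
        simp only [h1, h2, h3, if_true, true_and, if_false]; ring
      · have h3 : ∀ r < t, ¬ a r := by push Not at h2; exact h2
        rw [if_pos h1, if_pos ⟨h1, h3⟩, if_neg (fun h => h2 h.2)]; ring
    · simp [h1]
  have hbt : ∀ t, (if b t then θ else p) * β ^ t =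
      p * β ^ t + (θ - p) * ((if b t then 1 else 0) * β ^ t) := by
    intro t; split_ifs <;> ring
  have hsb : Summable fun t => (if b t then (1 : ℝ) else 0) * β ^ t :=
    summable_mul_pow_of_mem_Icc hβ0 hβ1 fun t => ite_mem _
  -- The copycat's pulls are those in `y`, one round later: hence the factor `β`.
  have hB : ∑' t, (if b t then θ else p) * β ^ t =
      p * (∑' t, β ^ t) + (θ - p) * (β * ∑' t, y t * β ^ t) := by
    simp_rw [hbt]
    rw [(hg.mul_left p).tsum_add (hsb.mul_left _), tsum_mul_left, tsum_mul_left,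
      hsb.tsum_eq_zero_add, if_neg hb0, zero_mul, zero_add, ← tsum_mul_left (a := β)]
    congr 2
    refine tsum_congr fun t => ?_
    simp only [hb, hy]
    ring
  -- Summing `e (t + 1) = e t + n t` gives `(1 - β) * E = β * W` without a case split on whether a
  -- first pull exists.
  have hE : ∑' t, e t * β ^ t = β * ((∑' t, e t * β ^ t) + ∑' t, n t * β ^ t) := by
    conv_lhs => rw [hse.tsum_eq_zero_add]
    rw [← hse.tsum_add hsn, ← tsum_mul_left]
    have he0 : e 0 = 0 := by simp [he]
    rw [he0, zero_mul, zero_add]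
    congr 1 with t
    have : e (t + 1) = e t + n t := by
      simp only [he, hn]
      by_cases h2 : ∃ r < t, a r
      · have h3 : ¬ ∀ r < t, ¬ a r := by push Not; exact h2
        obtain ⟨r, hr, har⟩ := h2
        rw [if_pos ⟨r, by omega, har⟩, if_pos ⟨r, hr, har⟩, if_neg (fun h => h3 h.2)]; ring
      · have h3 : ∀ r < t, ¬ a r := by push Not at h2; exact h2
        rw [if_neg h2]
        by_cases h1 : a t
        · rw [if_pos ⟨t, by omega, h1⟩, if_pos ⟨h1, h3⟩]; ring
        · rw [if_neg, if_neg (fun h => h1 h.1)]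
          · ring
          · rintro ⟨r, hr, har⟩
            rcases Nat.lt_succ_iff_lt_or_eq.1 hr with hr | rfl
            · exact h3 r hr har
            · exact h1 har
    rw [this]; ring
  have hYE : ∑' t, y t * β ^ t ≤ ∑' t, e t * β ^ t := by
    refine hsy.tsum_le_tsum (fun t => mul_le_mul_of_nonneg_right ?_ (by positivity)) hse
    simp only [hy, he]
    split_ifs with h1 h2 h2
    · rfl
    · exact absurd h1.2 h2
    · exact zero_le_one
    · rfl
  have hY0 : 0 ≤ ∑' t, y t * β ^ t :=
    tsum_nonneg fun t => mul_nonneg (ite_mem _).1 (by positivity)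
  rw [hA, hB]
  set W := ∑' t, n t * β ^ t
  set Y := ∑' t, y t * β ^ t
  set E := ∑' t, e t * β ^ t
  have h1 : (1 - β) * Y ≤ β * W := by nlinarith
  -- If `θ > p`, later pulls gain at most what pulling `R` forever would; otherwise they only lose.
  have h2 : (θ - p) * ((1 - β) * Y) ≤ max (θ - p) 0 * (β * W) :=
    (mul_le_mul_of_nonneg_right (le_max_left _ _) (mul_nonneg (by linarith) hY0)).trans
      (mul_le_mul_of_nonneg_left h1 (le_max_right _ _))
  nlinarith

/-! ### The law of Nature -/

/-- Resampling one coordinate preserves the law; this exposes coordinate `k` as a separate factor,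
independent of whatever does not read it. -/
lemma measurePreserving_update_infinitePi {ι α : Type*} [DecidableEq ι] [MeasurableSpace α]
    (μ : Measure α) [IsProbabilityMeasure μ] (k : ι) :
    MeasurePreserving (fun x : (ι → α) × α => Function.update x.1 k x.2)
      ((Measure.infinitePi fun _ : ι => μ).prod μ) (Measure.infinitePi fun _ : ι => μ) := by
  have hm : Measurable fun x : (ι → α) × α => Function.update x.1 k x.2 := by
    refine measurable_pi_lambda _ fun i => ?_
    by_cases h : i = k
    · subst h; simpa using measurable_snd
    · simp only [Function.update_of_ne h]
      exact (measurable_pi_apply i).comp measurable_fst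
  refine ⟨hm, Measure.eq_infinitePi _ fun s t ht => ?_⟩
  rw [Measure.map_apply hm (MeasurableSet.pi s.countable_toSet fun i _ => ht i)]
  by_cases hk : k ∈ s
  · have : (fun x : (ι → α) × α => Function.update x.1 k x.2) ⁻¹' Set.pi s t =
        (Set.pi (s.erase k) t) ×ˢ (t k) := by
      ext x
      simp only [Set.mem_preimage, Set.mem_pi, Set.mem_prod, Finset.mem_coe, Finset.mem_erase]
      constructor
      · refine fun h => ⟨fun i hi => ?_, ?_⟩
        · simpa [Function.update_of_ne hi.1] using h i hi.2
        · simpa using h k hk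
      · rintro ⟨h1, h2⟩ i hi
        by_cases h : i = k
        · subst h; simpa using h2
        · simpa [Function.update_of_ne h] using h1 i ⟨h, hi⟩
    rw [this, Measure.prod_prod, Measure.infinitePi_pi _ fun i _ => ht i,
      Finset.prod_erase_mul s (fun i => μ (t i)) hk]
  · have : (fun x : (ι → α) × α => Function.update x.1 k x.2) ⁻¹' Set.pi s t =
        (Set.pi s t) ×ˢ Set.univ := by
      ext x
      simp only [Set.mem_preimage, Set.mem_pi, Set.mem_prod, Finset.mem_coe, Set.mem_univ, and_true]
      refine forall₂_congr fun i hi => ?_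
      rw [Function.update_of_ne (by rintro rfl; exact hk hi)]
    rw [this, Measure.prod_prod, Measure.infinitePi_pi _ fun i _ => ht i, measure_univ, mul_one]

lemma measurePreserving_comp_equiv_infinitePi {ι α : Type*} [MeasurableSpace α]
    (μ : Measure α) [IsProbabilityMeasure μ] (e : ι ≃ ι) :
    MeasurePreserving (fun x : ι → α => x ∘ e)
      (Measure.infinitePi fun _ : ι => μ) (Measure.infinitePi fun _ : ι => μ) := by
  have hm : Measurable fun x : ι → α => x ∘ e :=
    measurable_pi_lambda _ fun i => measurable_pi_apply (e i)
  refine ⟨hm, Measure.eq_infinitePi _ fun s t ht => ?_⟩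
  rw [Measure.map_apply hm (MeasurableSet.pi s.countable_toSet fun i _ => ht i)]
  have : (fun x : ι → α => x ∘ e) ⁻¹' Set.pi s t =
      Set.pi (s.map e.toEmbedding) (fun i => t (e.symm i)) := by
    ext x
    simp only [Set.mem_preimage, Set.mem_pi, Finset.mem_coe, Finset.mem_map_equiv]
    exact ⟨fun h i hi => by simpa using h _ hi, fun h i hi => by simpa using h (e i) (by simpa)⟩
  rw [this, Measure.infinitePi_pi _ fun i _ => ht _, Finset.prod_map]
  simp

instance (μ : Measure unitInterval) [IsProbabilityMeasure μ] :
    IsProbabilityMeasure (natureLaw μ) := by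
  unfold natureLaw; infer_instance

lemma integral_indicator_lt_unitInterval {q : ℝ} (hq : q ∈ Set.Icc (0 : ℝ) 1) :
    ∫ v : unitInterval, (if (v : ℝ) < q then (1 : ℝ) else 0) = q := by
  have : (fun v : unitInterval => if (v : ℝ) < q then (1 : ℝ) else 0) =
      (Set.Iio (⟨q, hq⟩ : unitInterval)).indicator 1 := by
    ext v
    simp [Set.indicator_apply, ← Subtype.coe_lt_coe]
  rw [this, integral_indicator_one measurableSet_Iio, Measure.real, unitInterval.volume_Iio,
    ENNReal.toReal_ofReal hq.1]

/-- Since `g` ignores coordinate `k`, integrating that uniform coordinate first turns the indicator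
into the threshold. -/
lemma integral_indicator_lt_natureLaw (μ : Measure unitInterval) [IsProbabilityMeasure μ]
    [DecidableEq (Player × ℕ)] (k : Player × ℕ) {g : Nature → ℝ} (hg : Measurable g)
    (hg01 : ∀ ω, g ω ∈ Set.Icc (0 : ℝ) 1)
    (hgk : ∀ θ u v, g (θ, Function.update u k v) = g (θ, u)) :
    ∫ ω, (if (ω.2 k : ℝ) < g ω then (1 : ℝ) else 0) ∂natureLaw μ = ∫ ω, g ω ∂natureLaw μ := by
  have hmp : MeasurePreserving _
      (μ.prod ((Measure.infinitePi fun _ : Player × ℕ => (volume : Measure unitInterval)).prod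
        volume)) (natureLaw μ) := (MeasurePreserving.id μ).prod
    (measurePreserving_update_infinitePi (volume : Measure unitInterval) k)
  have hset : MeasurableSet {ω : Nature | (ω.2 k : ℝ) < g ω} :=
    measurableSet_lt (measurable_subtype_coe.comp ((measurable_pi_apply _).comp measurable_snd)) hg
  have hF : Measurable fun ω : Nature => if (ω.2 k : ℝ) < g ω then (1 : ℝ) else 0 :=
    Measurable.ite hset measurable_const measurable_const
  have hFi : ∀ {α : Type} [MeasurableSpace α] (ν : Measure α) [IsFiniteMeasure ν] {f : α → Nature}
      (_ : Measurable f),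
      Integrable (fun x => if ((f x).2 k : ℝ) < g (f x) then (1 : ℝ) else 0) ν := by
    intro α _ ν _ f hf
    refine Integrable.of_bound (hF.comp hf).aestronglyMeasurable 1 (.of_forall fun x => ?_)
    split_ifs <;> simp
  have hgi : Integrable g (natureLaw μ) :=
    Integrable.of_bound hg.aestronglyMeasurable 1 (.of_forall fun ω => by
      rw [Real.norm_of_nonneg (hg01 ω).1]; exact (hg01 ω).2)
  rw [← hmp.map_eq, integral_map hmp.measurable.aemeasurable hF.aestronglyMeasurable, hmp.map_eq,
    integral_prod _ (hFi _ hmp.measurable)]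
  conv_rhs => rw [natureLaw, integral_prod _ hgi]
  congr 1 with θ
  rw [integral_prod]
  · congr 1 with u
    simp only [Prod.map, id, Function.update_self, hgk]
    exact integral_indicator_lt_unitInterval (hg01 _)
  · exact hFi _ (hmp.measurable.comp measurable_prodMk_left)

/-! ### Expected rewards -/

/-- The number deciding a reward in round `t` is read only after the arms of that round are chosen.
-/
lemma history_update (p : ℝ) (S : Player → PureStrategy) [DecidableEq (Player × ℕ)] (i : Player)
    (t : ℕ) (θ : unitInterval) (u : Player × ℕ → unitInterval) (v : unitInterval) (r : ℕ)
    (hr : r ≤ t) (j : Player) :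
    history p S (θ, Function.update u (i, t) v) r j = history p S (θ, u) r j := by
  induction r generalizing j with
  | zero => rfl
  | succ r ih =>
    have ih := ih (by omega)
    have hne : (j, r) ≠ (i, t) := by rintro ⟨⟩; omega
    have hs : ∀ a, successProb p (θ, Function.update u (i, t) v) a = successProb p (θ, u) a := by
      rintro (_ | _) <;> rfl
    simp only [history, ih, rewardBit, Function.update_of_ne hne, hs]

lemma successProb_mem_Icc {p : ℝ} (hp : p ∈ Set.Icc (0 : ℝ) 1) (ω : Nature) (a : Arm) :
    successProb p ω a ∈ Set.Icc (0 : ℝ) 1 := by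
  cases a
  · exact hp
  · exact ω.1.2

lemma measurable_successProb_action (p : ℝ) (s : PureStrategy × PureStrategy) (i : Player) (t : ℕ) :
    Measurable fun ω => successProb p ω (action p (profile s) ω i t) :=
  measurable_successProb p measurable_id ((measurable_action p i t).comp measurable_prodMk_left)

lemma integral_reward (μ : Measure unitInterval) [IsProbabilityMeasure μ] {p : ℝ}
    (hp : p ∈ Set.Icc (0 : ℝ) 1) (s : PureStrategy × PureStrategy) (i : Player) (t : ℕ) :
    ∫ ω, reward p (profile s) ω i t ∂natureLaw μ =
      ∫ ω, successProb p ω (action p (profile s) ω i t) ∂natureLaw μ := by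
  classical
  rw [← integral_indicator_lt_natureLaw μ (i, t) (measurable_successProb_action p s i t)
    (fun ω => successProb_mem_Icc hp _ _)]
  · simp [reward, rewardBit]
  · intro θ u v
    rw [action, action, history_update p _ i t θ u v t le_rfl]
    cases profile s i (history p (profile s) (θ, u) t i) <;> rfl

lemma integrable_of_mem_Icc {α : Type*} [MeasurableSpace α] {ν : Measure α} [IsFiniteMeasure ν]
    {f : α → ℝ} (hf : Measurable f) (hf01 : ∀ x, f x ∈ Set.Icc (0 : ℝ) 1) : Integrable f ν :=
  Integrable.of_bound hf.aestronglyMeasurable 1 (.of_forall fun x => by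
    rw [Real.norm_of_nonneg (hf01 x).1]; exact (hf01 x).2)

/-! ### Integrals of discounted sums -/

section Discounted

variable {α : Type*} [MeasurableSpace α] {ν : Measure α} {β : ℝ}
  {f : ℕ → α → ℝ}

lemma integral_discounted_tsum [IsProbabilityMeasure ν] (hβ0 : 0 < β) (hβ1 : β < 1) (hf : ∀ t, Measurable (f t))
    (hf01 : ∀ t x, f t x ∈ Set.Icc (0 : ℝ) 1) :
    ∫ x, ∑' t, f t x * β ^ t ∂ν = ∑' t, (∫ x, f t x ∂ν) * β ^ t := by
  have hint : ∀ t, Integrable (f t) ν := fun t => integrable_of_mem_Icc (hf t) (hf01 t)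
  have hI : ∀ t, ∫ x, f t x ∂ν ∈ Set.Icc (0 : ℝ) 1 := fun t =>
    ⟨integral_nonneg fun x => (hf01 t x).1, by
      simpa using integral_mono (hint t) (integrable_const 1) fun x => (hf01 t x).2⟩
  rw [← integral_tsum_of_summable_integral_norm (fun t => (hint t).mul_const _)]
  · simp_rw [integral_mul_const]
  · refine (summable_mul_pow_of_mem_Icc hβ0 hβ1 hI).congr fun t => ?_
    rw [← integral_mul_const]
    congr 1 with x
    rw [Real.norm_of_nonneg (mul_nonneg (hf01 t x).1 (by positivity))]

lemma integrable_discounted_tsum [IsFiniteMeasure ν] (hβ0 : 0 < β) (hβ1 : β < 1)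
    (hf : ∀ t, Measurable (f t)) (hf01 : ∀ t x, f t x ∈ Set.Icc (0 : ℝ) 1) :
    Integrable (fun x => ∑' t, f t x * β ^ t) ν := by
  refine Integrable.of_bound
    (Measurable.tsum fun t => (hf t).mul_const _).aestronglyMeasurable (1 - β)⁻¹
    (.of_forall fun x => ?_)
  have h0 : 0 ≤ ∑' t, f t x * β ^ t :=
    tsum_nonneg fun t => mul_nonneg (hf01 t x).1 (by positivity)
  rw [Real.norm_of_nonneg h0, ← tsum_geometric_of_lt_one hβ0.le hβ1]
  exact Summable.tsum_le_tsum (fun t => mul_le_of_le_one_left (by positivity) (hf01 t x).2)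
    (summable_mul_pow_of_mem_Icc hβ0 hβ1 fun t => hf01 t x) (summable_geometric_of_lt_one hβ0.le hβ1)

end Discounted

/-! ### Expected gain against the copycat -/

section ZeroSum

variable {p β : ℝ}

/-- The discounted indicator of the first pull of `R`. -/
noncomputable def firstPullWeight (p β : ℝ) (s : PureStrategy) (ω : Nature) : ℝ :=
  open Classical in ∑' t, (if FirstPull p s ω t then 1 else 0) * β ^ t

lemma measurableSet_action_eq (p : ℝ) (s : PureStrategy × PureStrategy) (i : Player) (t : ℕ)
    (a : Arm) : MeasurableSet {ω | action p (profile s) ω i t = a} :=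
  ((measurable_action p i t).comp measurable_prodMk_left) (show MeasurableSet {a} from trivial)

lemma measurableSet_firstPull (p : ℝ) (s : PureStrategy) (t : ℕ) :
    MeasurableSet {ω | FirstPull p s ω t} := by
  simp only [FirstPull, Set.ofPred_and, Set.ofPred_forall]
  exact (measurableSet_action_eq _ _ _ _ _).inter (MeasurableSet.iInter fun r =>
    MeasurableSet.iInter fun _ => measurableSet_action_eq _ _ _ _ _)

open Classical in
lemma measurable_firstPull_indicator (p : ℝ) (s : PureStrategy) (t : ℕ) :
    Measurable fun ω => if FirstPull p s ω t then (1 : ℝ) else 0 :=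
  Measurable.ite (measurableSet_firstPull p s t) measurable_const measurable_const

open Classical in
lemma firstPull_indicator_mem_Icc (p : ℝ) (s : PureStrategy) (t : ℕ) (ω : Nature) :
    (if FirstPull p s ω t then (1 : ℝ) else 0) ∈ Set.Icc (0 : ℝ) 1 := by
  split_ifs <;> simp

lemma firstPullWeight_nonneg (hβ0 : 0 < β) (s : PureStrategy) (ω : Nature) :
    0 ≤ firstPullWeight p β s ω := by
  classical
  exact tsum_nonneg fun t => mul_nonneg (firstPull_indicator_mem_Icc p s t ω).1 (by positivity)

lemma integrable_firstPullWeight (hβ0 : 0 < β) (hβ1 : β < 1) (s : PureStrategy)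
    (ν : Measure Nature) [IsFiniteMeasure ν] : Integrable (firstPullWeight p β s) ν :=
  integrable_discounted_tsum hβ0 hβ1 (measurable_firstPull_indicator p s)
    (firstPull_indicator_mem_Icc p s)

lemma firstPullWeight_congr (s : PureStrategy) (θ θ' : unitInterval)
    (u : Player × ℕ → unitInterval) :
    firstPullWeight p β s (θ, u) = firstPullWeight p β s (θ', u) := by
  classical
  simp only [firstPullWeight, firstPull_congr p s θ θ' u]

lemma action_eq_L_of_firstPullWeight_eq_zero (hβ0 : 0 < β) (hβ1 : β < 1) (s : PureStrategy)
    (ω : Nature) (h : firstPullWeight p β s ω = 0) (t : ℕ) :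
    action p (profile (s, copycat)) ω .alice t = .L := by
  classical
  have hs := summable_mul_pow_of_mem_Icc hβ0 hβ1 fun t => firstPull_indicator_mem_Icc p s t ω
  have h0 := (hs.hasSum_iff.2 h)
  rw [hasSum_zero_iff_of_nonneg fun t =>
    mul_nonneg (firstPull_indicator_mem_Icc p s t ω).1 (by positivity)] at h0
  induction t using Nat.strong_induction_on with
  | _ t ih =>
    by_contra hc
    have hF : FirstPull p s ω t := ⟨Arm.ne_L_iff.1 hc, ih⟩
    have := congrFun h0 t
    simp only [hF, if_true, one_mul, Pi.zero_apply] at this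
    exact (pow_pos hβ0 t).ne' this

lemma integral_unitInterval_eq (f : ℝ → ℝ) :
    ∫ θ : unitInterval, f θ = ∫ x in (0 : ℝ)..1, f x := by
  rw [integral_subtype measurableSet_Icc f, integral_Icc_eq_integral_Ioc,
    intervalIntegral.integral_of_le zero_le_one]

lemma integral_sub_add_mul_max (hp : p ∈ Set.Icc (0 : ℝ) 1) (β : ℝ) :
    ∫ θ : unitInterval, (((θ : ℝ) - p) + β * max ((θ : ℝ) - p) 0) =
      (1 / 2 - p) + β * ((1 - p) ^ 2 / 2) := by
  rw [integral_unitInterval_eq fun x => (x - p) + β * max (x - p) 0]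
  have hc : Continuous fun x : ℝ => max (x - p) 0 := by fun_prop
  rw [intervalIntegral.integral_add (Continuous.intervalIntegrable (by fun_prop) _ _)
    (Continuous.intervalIntegrable (by fun_prop) _ _), intervalIntegral.integral_const_mul]
  have h1 : ∫ x in (0 : ℝ)..1, (x - p) = 1 / 2 - p := by
    rw [intervalIntegral.integral_sub (Continuous.intervalIntegrable (by fun_prop) _ _)
      (Continuous.intervalIntegrable (by fun_prop) _ _), integral_id]
    simp
  have h2 : ∫ x in (0 : ℝ)..p, max (x - p) 0 = 0 := by
    rw [intervalIntegral.integral_congr (g := fun _ => 0)]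
    · simp
    · intro x hx
      rw [Set.uIcc_of_le hp.1] at hx
      exact max_eq_right (by linarith [hx.2])
  have h3 : ∫ x in p..(1 : ℝ), max (x - p) 0 = (1 - p) ^ 2 / 2 := by
    rw [intervalIntegral.integral_congr (g := fun x => x - p)]
    · rw [intervalIntegral.integral_sub (Continuous.intervalIntegrable (by fun_prop) _ _)
        (Continuous.intervalIntegrable (by fun_prop) _ _), integral_id]
      simp; ring
    · intro x hx
      rw [Set.uIcc_of_le hp.2] at hx
      exact max_eq_left (by linarith [hx.1])
  rw [h1, ← intervalIntegral.integral_add_adjacent_intervals (hc.intervalIntegrable 0 p)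
    (hc.intervalIntegrable p 1), h2, h3, zero_add]

lemma integral_totalReward (μ : Measure unitInterval) [IsProbabilityMeasure μ]
    (hp : p ∈ Set.Icc (0 : ℝ) 1) (hβ0 : 0 < β) (hβ1 : β < 1) (s : PureStrategy × PureStrategy)
    (i : Player) :
    ∫ ω, totalReward p β (profile s) ω i ∂natureLaw μ =
      ∫ ω, ∑' t, successProb p ω (action p (profile s) ω i t) * β ^ t ∂natureLaw μ := by
  simp only [totalReward]
  rw [integral_discounted_tsum (f := fun t ω => reward p (profile s) ω i t) hβ0 hβ1
      (fun t => (measurable_reward p i t).comp measurable_prodMk_left)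
      (fun t ω => reward_mem_Icc p _ ω i t),
    integral_discounted_tsum hβ0 hβ1 (measurable_successProb_action p s i)
      (fun t ω => successProb_mem_Icc hp _ _)]
  simp only [integral_reward μ hp]

lemma integrable_totalReward (hβ0 : 0 < β) (hβ1 : β < 1) (p : ℝ) (i : Player)
    (ν : Measure ((PureStrategy × PureStrategy) × Nature)) [IsFiniteMeasure ν] :
    Integrable (fun x => totalReward p β (profile x.1) x.2 i) ν :=
  integrable_discounted_tsum hβ0 hβ1 (measurable_reward p i)
    (fun t x => reward_mem_Icc p _ x.2 i t)

lemma integrable_totalReward_nature (hβ0 : 0 < β) (hβ1 : β < 1) (p : ℝ)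
    (s : PureStrategy × PureStrategy) (i : Player) (ν : Measure Nature) [IsFiniteMeasure ν] :
    Integrable (fun ω => totalReward p β (profile s) ω i) ν :=
  integrable_discounted_tsum hβ0 hβ1
    (fun t => (measurable_reward p i t).comp measurable_prodMk_left)
    (fun t ω => reward_mem_Icc p _ ω i t)

lemma integral_utility_copycat_le (hp : p ∈ Set.Icc (0 : ℝ) 1) (hβ0 : 0 < β) (hβ1 : β < 1)
    (s : PureStrategy) :
    ∫ ω, utility p β (-1) (profile (s, copycat)) ω .alice ∂natureLaw volume ≤
      ((1 / 2 - p) + β * ((1 - p) ^ 2 / 2)) * ∫ ω, firstPullWeight p β s ω ∂natureLaw volume := by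
  classical
  have hm : ∀ i, Integrable (fun ω => ∑' t, successProb p ω
      (action p (profile (s, copycat)) ω i t) * β ^ t) (natureLaw volume) := fun i =>
    integrable_discounted_tsum hβ0 hβ1 (measurable_successProb_action p _ i)
      (fun t ω => successProb_mem_Icc hp _ _)
  have hk : Continuous fun θ : unitInterval => ((θ : ℝ) - p) + β * max ((θ : ℝ) - p) 0 := by
    fun_prop
  obtain ⟨C, hC⟩ := isCompact_univ.exists_bound_of_continuousOn hk.continuousOn
  have hW := integrable_firstPullWeight (p := p) hβ0 hβ1 s (natureLaw volume)
  calc ∫ ω, utility p β (-1) (profile (s, copycat)) ω .alice ∂natureLaw volume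
      = ∫ ω, ((∑' t, successProb p ω (action p (profile (s, copycat)) ω .alice t) * β ^ t) -
          ∑' t, successProb p ω (action p (profile (s, copycat)) ω .bob t) * β ^ t)
          ∂natureLaw volume := by
        rw [integral_sub (hm _) (hm _), ← integral_totalReward _ hp hβ0 hβ1,
          ← integral_totalReward _ hp hβ0 hβ1,
          ← integral_sub (integrable_totalReward_nature hβ0 hβ1 _ _ _ _)
            (integrable_totalReward_nature hβ0 hβ1 _ _ _ _)]
        simp only [utility, Player.other, neg_one_mul, sub_eq_add_neg]
    _ ≤ ∫ ω, firstPullWeight p β s ω * (((ω.1 : ℝ) - p) + β * max ((ω.1 : ℝ) - p) 0)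
          ∂natureLaw volume := by
        refine integral_mono ((hm _).sub (hm _))
          (hW.mul_bdd (c := C) (hk.comp continuous_fst).measurable.aestronglyMeasurable
            (.of_forall fun ω => hC ω.1 trivial)) fun ω => ?_
        have hs : ∀ a, successProb p ω a = if a = .R then (ω.1 : ℝ) else p := by
          rintro (_ | _) <;> simp [successProb]
        have := tsum_sub_tsum_copy_le hβ0 hβ1 (p := p) (θ := ω.1)
          (fun t => action p (profile (s, copycat)) ω .alice t = .R)
          (fun t => action p (profile (s, copycat)) ω .bob t = .R)
          (by rw [action_copycat_zero]; simp) (action_copycat_succ p s ω)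
        have hne : ∀ a : Arm, ¬ a = .R ↔ a = .L := by rintro (_ | _) <;> simp
        simp only [hne] at this
        simp only [hs, firstPullWeight, FirstPull]
        convert this
        · rfl
        · split_ifs with h
          · exact if_pos h
          · exact if_neg h
    _ = ((1 / 2 - p) + β * ((1 - p) ^ 2 / 2)) * ∫ ω, firstPullWeight p β s ω ∂natureLaw volume := by
        rw [← integral_sub_add_mul_max hp]
        -- The value `0` is arbitrary: freezing the first coordinate makes the integrand a product
        -- of a function of `θ` and one of `u`.
        have h0 : ∀ ω : Nature, firstPullWeight p β s ω = firstPullWeight p β s (0, ω.2) :=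
          fun ω => firstPullWeight_congr s _ _ _
        have e1 := integral_prod_mul (μ := (volume : Measure unitInterval))
          (ν := Measure.infinitePi fun _ : Player × ℕ => (volume : Measure unitInterval))
          (fun θ => ((θ : ℝ) - p) + β * max ((θ : ℝ) - p) 0)
          (fun u => firstPullWeight p β s (0, u))
        have e2 := integral_prod_mul (μ := (volume : Measure unitInterval))
          (ν := Measure.infinitePi fun _ : Player × ℕ => (volume : Measure unitInterval))
          (fun _ => (1 : ℝ)) (fun u => firstPullWeight p β s (0, u))
        simp only [one_mul, integral_const, probReal_univ, smul_eq_mul, mul_one] at e2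
        simp_rw [h0]
        rw [natureLaw, e2, ← e1]
        simp_rw [mul_comm]

end ZeroSum

/-! ### Exchanging the players -/

/-- Exchange the two players, keeping the round. -/
def playerRoundSwap : Player × ℕ ≃ Player × ℕ where
  toFun k := (k.1.other, k.2)
  invFun k := (k.1.other, k.2)
  left_inv k := by simp
  right_inv k := by simp

/-- Exchange the random numbers of the two players. -/
def swapNature (ω : Nature) : Nature := (ω.1, ω.2 ∘ playerRoundSwap)

lemma measurePreserving_swapNature (μ : Measure unitInterval) [IsProbabilityMeasure μ] :
    MeasurePreserving swapNature (natureLaw μ) (natureLaw μ) :=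
  (MeasurePreserving.id μ).prod (measurePreserving_comp_equiv_infinitePi volume playerRoundSwap)

lemma rewardBit_swapNature (p : ℝ) (ω : Nature) (i : Player) (t : ℕ) (a : Arm) :
    rewardBit p (swapNature ω) i t a = rewardBit p ω i.other t a := by
  cases a <;> rfl

lemma profile_swap (s : PureStrategy × PureStrategy) (i : Player) :
    profile s.swap i = profile s i.other := by cases i <;> rfl

lemma history_swap (p : ℝ) (s : PureStrategy × PureStrategy) (ω : Nature) (t : ℕ) (i : Player) :
    history p (profile s.swap) (swapNature ω) t i = history p (profile s) ω t i.other := by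
  induction t generalizing i with
  | zero => rfl
  | succ t ih => simp only [history, ih, profile_swap, rewardBit_swapNature]

lemma action_swap (p : ℝ) (s : PureStrategy × PureStrategy) (ω : Nature) (i : Player) (t : ℕ) :
    action p (profile s.swap) (swapNature ω) i t = action p (profile s) ω i.other t := by
  rw [action, action, history_swap, profile_swap]

lemma utility_swap (p β lam : ℝ) (s : PureStrategy × PureStrategy) (ω : Nature) (i : Player) :
    utility p β lam (profile s.swap) (swapNature ω) i = utility p β lam (profile s) ω i.other := by
  simp only [utility, totalReward, reward, action_swap, rewardBit_swapNature]

instance (μ : Measure unitInterval) [IsProbabilityMeasure μ] (σA σB : MixedStrategy) :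
    IsProbabilityMeasure (gameLaw μ σA σB) := by
  unfold gameLaw; infer_instance

lemma measurable_utility (p β lam : ℝ) (i : Player) :
    Measurable fun x : (PureStrategy × PureStrategy) × Nature =>
      utility p β lam (profile x.1) x.2 i :=
  (measurable_totalReward p β i).add ((measurable_totalReward p β i.other).const_mul lam)

lemma integrable_utility {β : ℝ} (hβ0 : 0 < β) (hβ1 : β < 1) (p lam : ℝ) (i : Player)
    (ν : Measure ((PureStrategy × PureStrategy) × Nature)) [IsFiniteMeasure ν] :
    Integrable (fun x => utility p β lam (profile x.1) x.2 i) ν :=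
  (integrable_totalReward hβ0 hβ1 p i ν).add
    ((integrable_totalReward hβ0 hβ1 p i.other ν).const_mul lam)

/-- Relabelling the players together with their reward numbers preserves the law of the game. -/
lemma expectedUtility_swap (μ : Measure unitInterval) [IsProbabilityMeasure μ] (p β lam : ℝ)
    (σA σB : MixedStrategy) (i : Player) :
    expectedUtility μ p β lam σA σB i = expectedUtility μ p β lam σB σA i.other := by
  have h : MeasurePreserving
      (Prod.map Prod.swap swapNature : (PureStrategy × PureStrategy) × Nature → _)
      (gameLaw μ σB σA) (gameLaw μ σA σB) :=
    (Measure.measurePreserving_swap (μ := (σB : Measure PureStrategy))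
      (ν := (σA : Measure PureStrategy))).prod (measurePreserving_swapNature μ)
  rw [expectedUtility, ← h.map_eq, integral_map h.measurable.aemeasurable
    (measurable_utility p β lam i).aestronglyMeasurable]
  simp only [Prod.map, utility_swap]
  rfl

lemma IsNashEquilibrium.swap {μ : Measure unitInterval} [IsProbabilityMeasure μ] {p β lam : ℝ}
    {σA σB : MixedStrategy} (h : IsNashEquilibrium μ p β lam σA σB) :
    IsNashEquilibrium μ p β lam σB σA := by
  refine ⟨fun τ => ?_, fun τ => ?_⟩
  · simpa only [expectedUtility_swap μ p β lam _ _ .bob, Player.other] using h.2 τ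
  · simpa only [expectedUtility_swap μ p β lam _ _ .alice, Player.other] using h.1 τ

/-! ### Equilibria of the zero-sum game -/

lemma expectedUtility_bob_eq_neg (μ : Measure unitInterval) (p β : ℝ) (σA σB : MixedStrategy) :
    expectedUtility μ p β (-1) σA σB .bob = -expectedUtility μ p β (-1) σA σB .alice := by
  rw [expectedUtility, expectedUtility, ← integral_neg]
  congr 1 with x
  simp only [utility, Player.other]
  ring

/-- Alice could copy Bob's `σB`, which yields `0` by symmetry, so her equilibrium payoff is at least
`0`; Bob's optimality says no `τ` brings it lower. -/
lemma IsNashEquilibrium.expectedUtility_nonneg {μ : Measure unitInterval} [IsProbabilityMeasure μ]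
    {p β : ℝ} {σA σB : MixedStrategy} (h : IsNashEquilibrium μ p β (-1) σA σB)
    (τ : MixedStrategy) : 0 ≤ expectedUtility μ p β (-1) σA τ .alice := by
  have h1 := h.1 σB
  have h2 := h.2 τ
  have h3 := expectedUtility_swap μ p β (-1) σB σB .bob
  rw [expectedUtility_bob_eq_neg, Player.other] at h3
  rw [expectedUtility_bob_eq_neg, expectedUtility_bob_eq_neg] at h2
  linarith

/-- The mixed strategy that selects a given pure strategy with certainty. -/
noncomputable def MixedStrategy.pure (τ : PureStrategy) : MixedStrategy :=
  ⟨Measure.dirac τ, inferInstance⟩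

@[simp] lemma MixedStrategy.coe_pure (τ : PureStrategy) :
    (MixedStrategy.pure τ : Measure PureStrategy) = Measure.dirac τ := rfl

lemma expectedUtility_pure (μ : Measure unitInterval) [IsProbabilityMeasure μ] {β : ℝ}
    (hβ0 : 0 < β) (hβ1 : β < 1) (p lam : ℝ) (σ : MixedStrategy) (τ : PureStrategy) (i : Player) :
    expectedUtility μ p β lam σ (.pure τ) i =
      ∫ s, ∫ ω, utility p β lam (profile (s, τ)) ω i ∂natureLaw μ ∂(σ : Measure PureStrategy) := by
  have hint := integrable_utility hβ0 hβ1 p lam i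
    (gameLaw μ σ (.pure τ))
  rw [expectedUtility, gameLaw, integral_prod _ hint, integral_prod _ hint.integral_prod_left]
  simp

/-- In an equilibrium, almost every strategy of Alice never pulls `R` against the copycat. -/
lemma IsNashEquilibrium.ae_forall_action_copycat_eq_L {p β : ℝ} (hp : 2 - Real.sqrt 2 < p)
    (hp1 : p ≤ 1) (hβ0 : 0 < β) (hβ1 : β < 1) {σA σB : MixedStrategy}
    (h : IsNashEquilibrium volume p β (-1) σA σB) :
    ∀ᵐ s ∂(σA : Measure PureStrategy), ∀ᵐ ω ∂natureLaw volume,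
      ∀ t, action p (profile (s, copycat)) ω .alice t = .L := by
  have hsq : Real.sqrt 2 ^ 2 = 2 := Real.sq_sqrt (by norm_num)
  have hs0 : 0 ≤ Real.sqrt 2 := Real.sqrt_nonneg 2
  have hp01 : p ∈ Set.Icc (0 : ℝ) 1 := ⟨by nlinarith, hp1⟩
  -- At `β = 1` the left side is `(p ^ 2 - 4 * p + 2) / 2`, with roots `2 ± √2`; this is where the
  -- threshold comes from.
  have hc : (1 / 2 - p) + β * ((1 - p) ^ 2 / 2) < 0 := by
    have h1 : β * ((1 - p) ^ 2 / 2) ≤ (1 - p) ^ 2 / 2 :=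
      mul_le_of_le_one_left (by positivity) hβ1.le
    nlinarith
  set c := (1 / 2 - p) + β * ((1 - p) ^ 2 / 2) with hcdef
  have hle := integral_utility_copycat_le hp01 hβ0 hβ1
  have hW0 : ∀ s, 0 ≤ ∫ ω, firstPullWeight p β s ω ∂natureLaw volume := fun s =>
    integral_nonneg fun ω => firstPullWeight_nonneg hβ0 s ω
  have hnonpos : ∀ s, ∫ ω, utility p β (-1) (profile (s, copycat)) ω .alice ∂natureLaw volume ≤ 0 :=
    fun s => (hle s).trans (mul_nonpos_of_nonpos_of_nonneg hc.le (hW0 s))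
  have hE := h.expectedUtility_nonneg (.pure copycat)
  rw [expectedUtility_pure _ hβ0 hβ1] at hE
  have hint : Integrable (fun s => ∫ ω, utility p β (-1) (profile (s, copycat)) ω .alice
      ∂natureLaw volume) (σA : Measure PureStrategy) := by
    have hm : Measurable fun x : PureStrategy × Nature => ((x.1, copycat), x.2) := by fun_prop
    have := (integrable_utility hβ0 hβ1 p (-1) .alice
      (((σA : Measure PureStrategy).prod (natureLaw volume)).map
        fun x : PureStrategy × Nature => ((x.1, copycat), x.2))).comp_measurable hm
    exact this.integral_prod_left
  -- Every pure strategy earns at most `0` against the copycat, yet the average over `σA` is at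
  -- least `0`.
  have hz : (fun s => -∫ ω, utility p β (-1) (profile (s, copycat)) ω .alice ∂natureLaw volume)
      =ᵐ[(σA : Measure PureStrategy)] 0 := by
    rw [← integral_eq_zero_iff_of_nonneg (fun s => neg_nonneg.2 (hnonpos s)) hint.neg, integral_neg]
    have := integral_nonpos (μ := (σA : Measure PureStrategy)) hnonpos
    linarith
  filter_upwards [hz] with s hs
  have hs' : ∫ ω, utility p β (-1) (profile (s, copycat)) ω .alice ∂natureLaw volume = 0 :=
    neg_eq_zero.1 hs
  have hWs : ∫ ω, firstPullWeight p β s ω ∂natureLaw volume = 0 := by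
    have h1 := hle s
    have h2 := hW0 s
    rw [hs'] at h1
    nlinarith
  rw [integral_eq_zero_iff_of_nonneg (firstPullWeight_nonneg hβ0 s)
    (integrable_firstPullWeight hβ0 hβ1 s _)] at hWs
  filter_upwards [hWs] with ω hω
  exact action_eq_L_of_firstPullWeight_eq_zero hβ0 hβ1 s ω hω

lemma action_copycat_eq_L {p : ℝ} {s : PureStrategy} {ω : Nature}
    (h : ∀ t, action p (profile (s, copycat)) ω .alice t = .L) (i : Player) (t : ℕ) :
    action p (profile (s, copycat)) ω i t = .L := by
  cases i
  · exact h t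
  · cases t with
    | zero => exact action_copycat_zero p s ω
    | succ t =>
      by_contra hc
      rw [← ne_eq, Arm.ne_L_iff, action_copycat_succ, h t] at hc
      simp at hc

/-- If neither player pulls `R` against the copycat, then neither does against the other. -/
lemma action_eq_L_of_copycat {p : ℝ} {s : PureStrategy × PureStrategy} {ω : Nature}
    (hA : ∀ t, action p (profile (s.1, copycat)) ω .alice t = .L)
    (hB : ∀ t, action p (profile (s.2, copycat)) (swapNature ω) .alice t = .L)
    (i : Player) (t : ℕ) : action p (profile s) ω i t = .L := by
  have hA' := action_copycat_eq_L hA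
  have hB' : ∀ i t, action p (profile (copycat, s.2)) ω i t = .L := by
    intro i t
    have := action_copycat_eq_L hB i.other t
    rwa [← Player.other_other i, ← action_swap p (copycat, s.2) ω i.other t]
  -- The same `ω` drives all three plays, so equal arms give equal reward bits and hence equal
  -- histories.
  have step : ∀ t,
      history p (profile s) ω t .alice = history p (profile (s.1, copycat)) ω t .alice ∧
      history p (profile s) ω t .bob = history p (profile (copycat, s.2)) ω t .bob := by
    intro t
    induction t with
    | zero => exact ⟨rfl, rfl⟩
    | succ t ih =>
      have a1 := hA' .alice t
      have a2 := hA' .bob t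
      have b1 := hB' .bob t
      have b2 := hB' .alice t
      simp only [action, profile] at a1 a2 b1 b2
      simp only [history, Player.other, profile, ih, a1, a2, b1, b2, and_self]
  cases i
  · rw [← hA' .alice t, action, action, (step t).1]; rfl
  · rw [← hB' .bob t, action, action, (step t).2]; rfl

/-- In every equilibrium of the zero-sum game, almost surely neither player ever pulls `R`. -/
lemma IsNashEquilibrium.ae_forall_action_eq_L {p β : ℝ} (hp : 2 - Real.sqrt 2 < p)
    (hp1 : p ≤ 1) (hβ0 : 0 < β) (hβ1 : β < 1) {σA σB : MixedStrategy}
    (hσ : IsNashEquilibrium volume p β (-1) σA σB) :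
    ∀ᵐ x ∂gameLaw volume σA σB, ∀ (i : Player) (t : ℕ),
      action p (profile x.1) x.2 i t = .L := by
  have hA := hσ.ae_forall_action_copycat_eq_L hp hp1 hβ0 hβ1
  have hB := hσ.swap.ae_forall_action_copycat_eq_L hp hp1 hβ0 hβ1
  have hmeas : MeasurableSet {x : (PureStrategy × PureStrategy) × Nature |
      ∀ i t, action p (profile x.1) x.2 i t = .L} := by
    simp only [Set.ofPred_forall]
    exact MeasurableSet.iInter fun i => MeasurableSet.iInter fun t =>
      measurable_action p i t (show MeasurableSet {Arm.L} from trivial)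
  rw [gameLaw, Measure.ae_prod_iff_ae_ae hmeas]
  filter_upwards [Measure.quasiMeasurePreserving_fst.ae hA,
    Measure.quasiMeasurePreserving_snd.ae hB] with s h1 h2
  -- Bob's statement concerns him in Alice's seat; invariance under `swapNature` transports it to
  -- the same `ω`.
  filter_upwards [h1, (measurePreserving_swapNature volume).quasiMeasurePreserving.ae h2]
    with ω h1 h2
  exact action_eq_L_of_copycat h1 h2

end OneArmedBandit

theorem proposition12 (p β : ℝ) (hp : 2 - Real.sqrt 2 < p) (hp1 : p ≤ 1)
    (hβ0 : 0 < β) (hβ1 : β < 1) (σA σB : OneArmedBandit.MixedStrategy)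
    (hσ : OneArmedBandit.IsNashEquilibrium (MeasureTheory.volume : MeasureTheory.Measure unitInterval)
      p β (-1) σA σB) :
    ∀ᵐ x ∂(OneArmedBandit.gameLaw (MeasureTheory.volume : MeasureTheory.Measure unitInterval) σA σB),
      ∀ (i : OneArmedBandit.Player) (t : ℕ),
        OneArmedBandit.action p (OneArmedBandit.profile x.1) x.2 i t = OneArmedBandit.Arm.L :=
  hσ.ae_forall_action_eq_L hp hp1 hβ0 hβ1
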